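/- Let $K$ be a field, let $G$ be a connected finite simple graph on the vertex set $[n]=\{1,\dots,n\}$ containing an odd cycle, and let $2k+1$ be the smallest length of an odd cycle of $G$. Let $S=K[x_1,\dots,x_n]$, $\mathfrak m=(x_1,\dots,x_n)$, and let $I=I(G)=(x_ix_j : \{i,j\}\in E(G))\subset S$ be the edge ideal of $G$. Write $\mathrm{Min}(I)$ for the set of minimal primes of $I$ and $\mathrm{Ass}(J)$ for the set of associated primes of $S/J$. Let $\mathrm{Ass}^\infty(I)$ be the set of monomial persistent primes of $I$, i.e. of those monomial prime ideals $P\supseteq I$ (a monomial prime ideal is a prime ideal generated by monomials) that belong to $\mathrm{Ass}(I^m)$ for some $m\ge 1$ and satisfy $P\in\mathrm{Ass}(I^{m})\Rightarrow P\in\mathrm{Ass}(I^{m+1})$ for all $m\ge 1$. For a cycle $C$ of $G$, let $V(C)$ be its vertex set and $N(C)$ the set of all vertices of $G$ adjacent to some vertex of $C$. Then $$\mathrm{Ass}^\infty(I)=\mathrm{Min}(I)\cup\{\mathfrak m\}\quad\Longleftrightarrow\quad V(C)\cup N(C)=[n]\ \text{ for every odd cycle } C \text{ of } G.$$ Moreover,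 if this condition holds, then $\mathrm{Ass}(I^m)=\mathrm{Min}(I)$ for $1\le m\le k$ and $\mathrm{Ass}(I^m)=\mathrm{Min}(I)\cup\{\mathfrak m\}$ for all $m\ge k+1$. In particular, $I$ is then almost normally torsionfree, that is, there are an integer $k'\ge 1$ and a monomial prime ideal $P$ such that $\mathrm{Ass}(I^m)=\mathrm{Min}(I)$ for $1\le m\le k'$ and $\mathrm{Ass}(I^m)\subseteq\mathrm{Min}(I)\cup\{P\}$ for all $m\ge k'+1$. -/

import Mathlib

open MvPolynomial

/-- The edge ideal of a simple graph `G`: the ideal generated by the products `x_i x_j` over the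
edges `{i, j}` of `G`. -/
noncomputable def edgeIdeal (K : Type*) [Field K] {V : Type*} (G : SimpleGraph V) :
    Ideal (MvPolynomial V K) :=
  Ideal.span {f | ∃ i j, G.Adj i j ∧ f = X i * X j}

/-- An ideal of a polynomial ring generated by monomials. -/
def IsMonomialIdeal {K : Type*} [Field K] {V : Type*} (I : Ideal (MvPolynomial V K)) : Prop :=
  ∃ s : Set (V →₀ ℕ), I = Ideal.span ((fun a => monomial a (1 : K)) '' s)

/-- `Ass(I)`, the set of associated primes of the module `R ⧸ I`. -/
def assPrimes {R : Type*} [CommRing R] (I : Ideal R) : Set (Ideal R) :=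
  associatedPrimes R (R ⧸ I)

/-- `P` is a monomial persistent prime ideal of `I`: a monomial prime ideal containing `I` which is
associated to some power `I ^ k`, `k ≥ 1`, and such that, whenever `P` is associated to a power
`I ^ k`, it is also associated to `I ^ (k + 1)`. -/
structure IsPersistentPrime {K : Type*} [Field K] {V : Type*}
    (I P : Ideal (MvPolynomial V K)) : Prop where
  isPrime : P.IsPrime
  isMonomial : IsMonomialIdeal P
  le : I ≤ P
  exists_mem : ∃ k, 1 ≤ k ∧ P ∈ assPrimes (I ^ k)
  persistent : ∀ k, 1 ≤ k → P ∈ assPrimes (I ^ k) → P ∈ assPrimes (I ^ (k + 1))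

/-- `Ass^∞(I)`, the set of monomial persistent prime ideals of `I`. -/
def assInfty {K : Type*} [Field K] {V : Type*} (I : Ideal (MvPolynomial V K)) :
    Set (Ideal (MvPolynomial V K)) :=
  {P | IsPersistentPrime I P}

/-- A monomial ideal `I` is almost normally torsionfree if there are a positive integer `k` and a
monomial prime ideal `P` with `Ass(I^m) = Min(I)` for `1 ≤ m ≤ k` and
`Ass(I^m) ⊆ Min(I) ∪ {P}` for `m ≥ k + 1`. -/
def IsAlmostNormallyTorsionfree {K : Type*} [Field K] {V : Type*}
    (I : Ideal (MvPolynomial V K)) : Prop :=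
  IsMonomialIdeal I ∧
    ∃ k : ℕ, 1 ≤ k ∧ ∃ P : Ideal (MvPolynomial V K), P.IsPrime ∧ IsMonomialIdeal P ∧
      (∀ m, 1 ≤ m → m ≤ k → assPrimes (I ^ m) = I.minimalPrimes) ∧
      (∀ m, k + 1 ≤ m → assPrimes (I ^ m) ⊆ I.minimalPrimes ∪ {P})

/-- `N(A)`, the set of all vertices adjacent to some vertex in `A`. -/
def nbrs {V : Type*} (G : SimpleGraph V) (A : Set V) : Set V :=
  {v | ∃ a ∈ A, G.Adj a v}

/-- `G` has a cycle of length `r`. -/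
def HasCycleOfLength {V : Type*} (G : SimpleGraph V) (r : ℕ) : Prop :=
  ∃ (u : V) (c : G.Walk u u), c.IsCycle ∧ c.length = r

/-- Every odd cycle `C` of `G` satisfies `V(C) ∪ N(C) = V(G)`. -/
def OddCyclesDominating {V : Type*} (G : SimpleGraph V) : Prop :=
  ∀ (u : V) (c : G.Walk u u), c.IsCycle → Odd c.length →
    {v | v ∈ c.support} ∪ nbrs G {v | v ∈ c.support} = Set.univ

/-! A monomial x^b lies in I^m exactly when m edges, repetitions allowed, can be packed into b
(`monomial_mem_edgeIdeal_pow`). An associated prime of the monomial ideal I^m is the colon of I^m by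
a single monomial x^a, hence is generated by a set U of variables (`exists_monomial_of_colon`,
`eq_span_X_of_colon`). The theorem thus becomes a question about packings: weights bound them from
above (`Packs.mul_le_sum`), and weighted König duality on bipartite subgraphs produces them
(`exists_cover_packs`).

Suppose all odd cycles dominate. If U omits a vertex y, the vertices of U without neighbours outside
U span a bipartite graph, since an odd cycle there would have to reach y; König duality then forces
U to be a minimal vertex cover (`minimal_cover_of_packs`). If U is everything and the power is at
most k, the packings involved have too few edges to contain an odd cycle, and duality gives a
contradiction (`not_forall_packs_single_add`). From the power k + 1 on, a shortest odd cycle times a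
power of one of its edges has degree one too small, while every extra vertex completes a packing
(`idealOfVars_mem_assPrimes`).

Conversely, if an odd cycle C fails to dominate w, take a maximal independent set A containing w
among the vertices outside V(C) ∪ N(C). The variables outside A generate an associated prime that is
neither minimal nor 𝔪 (`exists_isPersistentPrime_of_not_dominating`); it persists because it omits
an end of an edge (`mem_assPrimes_succ_of_adj`). -/

/-! ### Odd closed walks and bipartiteness -/

section OddCycles

variable {V : Type*} {G : SimpleGraph V}

/-- A graph with an odd closed walk has an odd cycle. -/
theorem exists_odd_cycle_of_odd_closed_walk (u : V) (w : G.Walk u u) (hw : Odd w.length) :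
    ∃ (v : V) (c : G.Walk v v), c.IsCycle ∧ Odd c.length := by
  induction hl : w.length using Nat.strong_induction_on generalizing u w with
  | _ l ih =>
  subst hl
  by_cases hp : w.tail.IsPath
  · refine ⟨u, w, SimpleGraph.Walk.isCycle_iff_isPath_tail_and_le_length.2 ⟨hp, ?_⟩, hw⟩
    by_contra h3
    have h1 : w.length = 1 := by
      obtain ⟨j, hj⟩ := hw
      omega
    exact G.loopless.irrefl _ (SimpleGraph.Walk.adj_of_length_eq_one h1)
  · rw [SimpleGraph.Walk.isPath_iff_isSubwalk_imp_nil] at hp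
    push Not at hp
    obtain ⟨v, c, ⟨ru, rv, hc⟩, hnil⟩ := hp
    have hpos : 0 < c.length := SimpleGraph.Walk.not_nil_iff_lt_length.1 hnil
    have hwn : ¬ w.Nil := by
      rw [SimpleGraph.Walk.not_nil_iff_lt_length]
      exact hw.pos
    have hlen : w.length = ru.length + c.length + rv.length + 1 := by
      rw [← SimpleGraph.Walk.length_tail_add_one hwn, hc]
      simp
    -- The closed subwalk is shorter than the walk; if it is even, cutting it out leaves a shorter
    -- odd closed walk.
    by_cases hodd : Odd c.length
    · exact ih c.length (by omega) v c hodd rfl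
    · refine ih (ru.length + rv.length + 1) (by omega) u
        (SimpleGraph.Walk.cons (w.adj_snd hwn) (ru.append rv)) ?_ (by simp)
      simp only [SimpleGraph.Walk.length_cons, SimpleGraph.Walk.length_append]
      rw [Nat.not_odd_iff_even] at hodd
      rw [hlen] at hw
      obtain ⟨a, ha⟩ := hodd
      obtain ⟨d, hd⟩ := hw
      exact ⟨d - a, by omega⟩

theorem exists_bipartition_of_forall_cycle_not_odd
    (h : ∀ (v : V) (c : G.Walk v v), c.IsCycle → ¬ Odd c.length) :
    ∃ A : Set V, ∀ u v, G.Adj u v → (u ∈ A ↔ v ∉ A) := by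
  have h2 : G.Colorable 2 := by
    rw [SimpleGraph.two_colorable_iff_forall_loop_even]
    intro u w
    rw [← Nat.not_odd_iff_even]
    intro hw
    obtain ⟨v, c, hc, ho⟩ := exists_odd_cycle_of_odd_closed_walk u w hw
    exact h v c hc ho
  obtain ⟨col⟩ := h2
  refine ⟨{v | col v = 0}, fun u v huv => ?_⟩
  have := col.valid huv
  simp only [Set.mem_ofPred_eq]
  omega

end OddCycles

/-! ### Packings of edges into an exponent vector -/

/-- The monomial with exponent `b` is divisible by a product of `m` (not necessarily distinct) edges
of `G`. -/
def Packs {V : Type*} (G : SimpleGraph V) (m : ℕ) (b : V →₀ ℕ) : Prop :=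
  ∃ s : Multiset (V →₀ ℕ), s.card = m ∧
    (∀ e ∈ s, ∃ i j, G.Adj i j ∧ e = Finsupp.single i 1 + Finsupp.single j 1) ∧ s.sum ≤ b

namespace Packs

variable {V : Type*} {G H : SimpleGraph V} {m m' : ℕ} {b b' : V →₀ ℕ}

theorem zero (b : V →₀ ℕ) : Packs G 0 b := ⟨0, by simp⟩

theorem edge {i j : V} (h : G.Adj i j) : Packs G 1 (Finsupp.single i 1 + Finsupp.single j 1) :=
  ⟨{Finsupp.single i 1 + Finsupp.single j 1}, by simp, by simpa using ⟨i, j, h, rfl⟩, by simp⟩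

theorem mono_right (h : Packs G m b) (hb : b ≤ b') : Packs G m b' := by
  obtain ⟨s, h1, h2, h3⟩ := h
  exact ⟨s, h1, h2, h3.trans hb⟩

theorem mono_graph (h : Packs G m b) (hG : G ≤ H) : Packs H m b := by
  obtain ⟨s, h1, h2, h3⟩ := h
  refine ⟨s, h1, fun e he => ?_, h3⟩
  obtain ⟨i, j, hij, rfl⟩ := h2 e he
  exact ⟨i, j, hG hij, rfl⟩

theorem add (h : Packs G m b) (h' : Packs G m' b') : Packs G (m + m') (b + b') := by
  obtain ⟨s, h1, h2, h3⟩ := h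
  obtain ⟨s', h1', h2', h3'⟩ := h'
  refine ⟨s + s', by simp [h1, h1'], fun e he => ?_, by
    rw [Multiset.sum_add]; exact add_le_add h3 h3'⟩
  rcases Multiset.mem_add.1 he with he | he
  · exact h2 e he
  · exact h2' e he

theorem mono_left (h : Packs G m b) (hm : m' ≤ m) : Packs G m' b := by
  obtain ⟨s, h1, h2, h3⟩ := h
  have hle : (s.toList.take m' : Multiset (V →₀ ℕ)) ≤ s := by
    conv_rhs => rw [← Multiset.coe_toList s]
    exact (List.take_sublist _ _).subperm
  refine ⟨s.toList.take m', by simp [h1, hm], fun e he => h2 e (Multiset.mem_of_le hle he), ?_⟩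
  refine le_trans ?_ h3
  obtain ⟨t, ht⟩ := Multiset.le_iff_exists_add.1 hle
  conv_rhs => rw [ht, Multiset.sum_add]
  exact le_self_add

/-- If every edge inside the support of `b` has at least `c` ends in `T`, then packing `m` edges
needs weight at least `c * m` on `T`. -/
theorem mul_le_sum (h : Packs G m b) (T : Finset V) [DecidableEq V] (c : ℕ)
    (hT : ∀ i j, G.Adj i j → b i ≠ 0 → b j ≠ 0 →
      c ≤ (if i ∈ T then 1 else 0) + (if j ∈ T then 1 else 0)) :
    c * m ≤ ∑ v ∈ T, b v := by
  obtain ⟨s, rfl, h2, h3⟩ := h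
  let φ : (V →₀ ℕ) →+ ℕ :=
    { toFun := fun f => ∑ v ∈ T, f v
      map_zero' := by simp
      map_add' := fun f g => by simp [Finset.sum_add_distrib] }
  have h4 : φ s.sum ≤ φ b := Finset.sum_le_sum fun v _ => h3 v
  refine le_trans ?_ h4
  rw [map_multiset_sum]
  have h5 := Multiset.card_nsmul_le_sum (s := s.map φ) (a := c) ?_
  · simpa [mul_comm] using h5
  · intro x hx
    obtain ⟨e, he, rfl⟩ := Multiset.mem_map.1 hx
    obtain ⟨i, j, hij, rfl⟩ := h2 e he
    -- Every edge used in the packing has both ends in the support of `b`, so the assumption on `T`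
    -- applies to it.
    have hle := (Multiset.single_le_sum (fun _ _ => zero_le) _ he).trans h3
    have hi := hle i
    have hj := hle j
    simp only [Finsupp.add_apply, Finsupp.single_eq_same] at hi hj
    refine (hT i j hij (by omega) (by omega)).trans ?_
    simp [φ, Finset.sum_add_distrib, Finsupp.single_apply]

/-- The vertices of a walk can be grouped into consecutive edges. -/
theorem of_walk {u v : V} (w : G.Walk u v) :
    Packs G ((w.length + 1) / 2) (w.support.map fun x => Finsupp.single x 1).sum := by
  match w with
  | .nil => simpa using Packs.zero _
  | .cons h .nil => simpa using Packs.edge h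
  | .cons h (.cons h' p) =>
    have h1 := (Packs.edge h).add (of_walk p)
    have h2 : 1 + (p.length + 1) / 2 = (p.length + 1 + 1 + 1) / 2 := by omega
    rw [h2] at h1
    simpa [add_assoc] using h1

end Packs

/-! ### Weighted König theorem -/

section Koenig

variable {V : Type*} [Fintype V]

open Classical in
/-- A weighted version of König's theorem for bipartite graphs. -/
theorem exists_cover_packs (H : SimpleGraph V) (A : Set V)
    (hA : ∀ u v, H.Adj u v → (u ∈ A ↔ v ∉ A)) (b : V →₀ ℕ) :
    ∃ C : Finset V, (∀ u v, H.Adj u v → u ∈ C ∨ v ∈ C) ∧ Packs H (∑ v ∈ C, b v) b := by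
  let N : Finset V → Finset V := fun S => Finset.univ.filter fun v => ∃ u ∈ S, H.Adj u v
  -- `S` maximizes the deficiency b(S) − b(N(S)); its value `d` is nonnegative by comparison with
  -- the empty set.
  obtain ⟨S, hS, hmax⟩ := Finset.exists_max_image A.toFinset.powerset
    (fun S => ((∑ v ∈ S, b v : ℕ) : ℤ) - (∑ v ∈ N S, b v : ℕ)) ⟨∅, by simp⟩
  rw [Finset.mem_powerset] at hS
  have hSA : ∀ v ∈ S, v ∈ A := fun v hv => by simpa using hS hv
  have h0 := hmax ∅ (by simp)
  have hN0 : N ∅ = ∅ := by simp [N]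
  simp only [hN0, Finset.sum_empty, Nat.cast_zero, sub_zero] at h0
  obtain ⟨d, hd⟩ : ∃ d : ℕ, ∑ v ∈ S, b v = (∑ v ∈ N S, b v) + d :=
    ⟨(∑ v ∈ S, b v) - ∑ v ∈ N S, b v, by omega⟩
  let a : V → ℕ := fun v => if v ∈ A then b v else 0
  -- Each vertex is blown up into b(v) copies, and `d` dummy vertices joined to every copy on the
  -- `A` side absorb the deficiency, so that Hall's condition holds.
  let t : (Σ v, Fin (a v)) → Finset ((Σ v, Fin (b v)) ⊕ Fin d) := fun x =>
    Finset.univ.filter fun y => ∀ z, y = Sum.inl z → H.Adj x.1 z.1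
  have hxA : ∀ x : Σ v, Fin (a v), x.1 ∈ A := by
    rintro ⟨v, i⟩
    by_contra hv
    have := i.2
    simp [a, hv] at this
  have hall : ∀ T : Finset (Σ v, Fin (a v)), T.card ≤ (T.biUnion t).card := by
    intro T
    rcases T.eq_empty_or_nonempty with rfl | ⟨x0, hx0⟩
    · simp
    let S' := T.image Sigma.fst
    have hS' : ∀ v ∈ S', v ∈ A := by
      intro v hv
      obtain ⟨x, _, rfl⟩ := Finset.mem_image.1 hv
      exact hxA x
    have h1 : T.card ≤ ∑ v ∈ S', b v := by
      have : T ⊆ S'.sigma fun _ => Finset.univ := fun x hx => by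
        simpa [S'] using ⟨x.2, hx⟩
      refine (Finset.card_le_card this).trans ?_
      rw [Finset.card_sigma]
      refine Finset.sum_le_sum fun v hv => ?_
      simp [a, hS' v hv]
    have h2 : (∑ v ∈ N S', b v) + d ≤ (T.biUnion t).card := by
      have : ((N S').sigma fun v => (Finset.univ : Finset (Fin (b v)))).disjSum
          (Finset.univ : Finset (Fin d)) ⊆ T.biUnion t := by
        intro y hy
        rcases y with z | i
        · simp only [Finset.inl_mem_disjSum, Finset.mem_sigma, Finset.mem_filter, N, S',
            Finset.mem_univ, true_and, and_true, Finset.mem_image] at hy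
          obtain ⟨_, ⟨x, hx, rfl⟩, hadj⟩ := hy
          refine Finset.mem_biUnion.2 ⟨x, hx, ?_⟩
          simp only [t, Finset.mem_filter, Finset.mem_univ, true_and]
          rintro _ ⟨⟩
          exact hadj
        · exact Finset.mem_biUnion.2 ⟨x0, hx0, by simp [t]⟩
      refine le_trans ?_ (Finset.card_le_card this)
      rw [Finset.card_disjSum, Finset.card_sigma]
      simp
    have h3 := hmax S' (Finset.mem_powerset.2 fun v hv => by simpa using hS' v hv)
    omega
  obtain ⟨f, hf, hft⟩ := (Finset.all_card_le_biUnion_card_iff_exists_injective t).1 hall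
  -- The pairs matched without a dummy; at least b(A) − d of them exist.
  let M : Finset ((Σ v, Fin (a v)) × (Σ v, Fin (b v))) :=
    Finset.univ.filter fun p => f p.1 = Sum.inl p.2
  have hM : ∀ p ∈ M, f p.1 = Sum.inl p.2 := fun p hp => by simpa [M] using hp
  have hMadj : ∀ p ∈ M, H.Adj p.1.1 p.2.1 := fun p hp => by
    have := hft p.1
    simp only [t, Finset.mem_filter, Finset.mem_univ, true_and] at this
    exact this _ (hM p hp)
  have hcard : ∑ v ∈ A.toFinset, b v ≤ M.card + d := by
    have h1 : (Finset.univ.image f) ⊆ (M.image Prod.snd).disjSum (Finset.univ : Finset (Fin d)) := by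
      intro y hy
      obtain ⟨x, _, rfl⟩ := Finset.mem_image.1 hy
      rcases hx : f x with z | i
      · rw [Finset.inl_mem_disjSum]
        exact Finset.mem_image.2 ⟨(x, z), by simp [M, hx], rfl⟩
      · simp
    have h2 := Finset.card_le_card h1
    rw [Finset.card_image_of_injective _ hf, Finset.card_disjSum] at h2
    have h3 : (Finset.univ : Finset (Σ v, Fin (a v))).card = ∑ v ∈ A.toFinset, b v := by
      rw [Finset.card_univ, Fintype.card_sigma]
      simp only [Fintype.card_fin, a]
      rw [← Finset.sum_filter]
      exact Finset.sum_congr (by ext; simp) fun _ _ => rfl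
    have h4 : (M.image Prod.snd).card ≤ M.card := Finset.card_image_le
    simp only [Finset.card_univ, Fintype.card_fin] at h2 h3
    omega
  -- The weight of this cover is b(A) − b(S) + b(N(S)) = b(A) − d, at most the size of `M`.
  refine ⟨(A.toFinset \ S) ∪ N S, ?_, ?_⟩
  · have key : ∀ u v, H.Adj u v → u ∈ A → u ∈ (A.toFinset \ S) ∪ N S ∨ v ∈ (A.toFinset \ S) ∪ N S := by
      intro u v huv hu
      by_cases huS : u ∈ S
      · right
        exact Finset.mem_union_right _ (by simpa [N] using ⟨u, huS, huv⟩)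
      · left
        exact Finset.mem_union_left _ (by simp [hu, huS])
    intro u v huv
    by_cases hu : u ∈ A
    · exact key u v huv hu
    · exact (key v u huv.symm (by simpa [hu] using hA u v huv)).symm
  · have hdisj : Disjoint (A.toFinset \ S) (N S) := by
      rw [Finset.disjoint_left]
      intro v hv hv'
      simp only [N, Finset.mem_filter, Finset.mem_univ, true_and] at hv'
      obtain ⟨u, hu, huv⟩ := hv'
      have h1 : v ∈ A := by
        have := (Finset.mem_sdiff.1 hv).1
        simpa using this
      exact (hA u v huv).1 (hSA u hu) h1
    have hsum : ∑ v ∈ (A.toFinset \ S) ∪ N S, b v ≤ M.card := by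
      rw [Finset.sum_union hdisj]
      have := Finset.sum_sdiff (f := fun v => b v) hS
      omega
    refine Packs.mono_left ?_ hsum
    refine ⟨M.val.map fun p => Finsupp.single p.1.1 1 + Finsupp.single p.2.1 1, by simp, ?_, ?_⟩
    · intro e he
      obtain ⟨p, hp, rfl⟩ := Multiset.mem_map.1 he
      exact ⟨_, _, hMadj p hp, rfl⟩
    · intro v
      change (∑ p ∈ M, (Finsupp.single p.1.1 1 + Finsupp.single p.2.1 1) : V →₀ ℕ) v ≤ b v
      rw [Finsupp.finsetSum_apply]
      -- A vertex of `A` occurs only as a first end, any other only as a second end. Its occurrences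
      -- inject into its copies, since `f` is a function in the first case and is injective in the
      -- second.
      by_cases hv : v ∈ A
      · have h1 : ∑ p ∈ M, (Finsupp.single p.1.1 1 + Finsupp.single p.2.1 1 : V →₀ ℕ) v =
            (M.filter fun p => p.1.1 = v).card := by
          rw [Finset.card_filter]
          refine Finset.sum_congr rfl fun p hp => ?_
          have : p.2.1 ≠ v := fun h => (hA _ _ (hMadj p hp)).1 (hxA p.1) (h ▸ hv)
          simp [Finsupp.single_apply, this]
        rw [h1]
        have h2 : Set.InjOn Prod.fst (↑(M.filter fun p => p.1.1 = v) :
            Set ((Σ v, Fin (a v)) × (Σ v, Fin (b v)))) := by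
          intro p hp q hq hpq
          have hp := hM p (Finset.mem_filter.1 hp).1
          have hq := hM q (Finset.mem_filter.1 hq).1
          rw [hpq, hq] at hp
          exact Prod.ext hpq (Sum.inl_injective hp).symm
        rw [← Finset.card_image_of_injOn h2]
        have h3 : (M.filter fun p => p.1.1 = v).image Prod.fst ⊆
            ({v} : Finset V).sigma fun _ => Finset.univ := by
          intro x hx
          obtain ⟨p, hp, rfl⟩ := Finset.mem_image.1 hx
          simpa using (Finset.mem_filter.1 hp).2
        refine (Finset.card_le_card h3).trans ?_
        simp [a, hv]
      · have h1 : ∑ p ∈ M, (Finsupp.single p.1.1 1 + Finsupp.single p.2.1 1 : V →₀ ℕ) v =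
            (M.filter fun p => p.2.1 = v).card := by
          rw [Finset.card_filter]
          refine Finset.sum_congr rfl fun p hp => ?_
          have : p.1.1 ≠ v := fun h => hv (h ▸ hxA p.1)
          simp [Finsupp.single_apply, this]
        rw [h1]
        have h2 : Set.InjOn Prod.snd (↑(M.filter fun p => p.2.1 = v) :
            Set ((Σ v, Fin (a v)) × (Σ v, Fin (b v)))) := by
          intro p hp q hq hpq
          have hp := hM p (Finset.mem_filter.1 hp).1
          have hq := hM q (Finset.mem_filter.1 hq).1
          rw [hpq, ← hq] at hp
          exact Prod.ext (hf hp) hpq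
        rw [← Finset.card_image_of_injOn h2]
        have h3 : (M.filter fun p => p.2.1 = v).image Prod.snd ⊆
            ({v} : Finset V).sigma fun _ => Finset.univ := by
          intro x hx
          obtain ⟨p, hp, rfl⟩ := Finset.mem_image.1 hx
          simpa using (Finset.mem_filter.1 hp).2
        refine (Finset.card_le_card h3).trans ?_
        simp

end Koenig

/-! ### Associated primes of monomial ideals -/

section MonomialIdeals

variable {K : Type*} [Field K] {V : Type*}

theorem IsMonomialIdeal.mem_iff {J : Ideal (MvPolynomial V K)} (hJ : IsMonomialIdeal J)
    (f : MvPolynomial V K) : f ∈ J ↔ ∀ a ∈ f.support, monomial a (1 : K) ∈ J := by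
  classical
  obtain ⟨s, rfl⟩ := hJ
  simp [mem_ideal_span_monomial_image, support_monomial]

theorem monomial_mem_of_monomial_one_mem {J : Ideal (MvPolynomial V K)} {a : V →₀ ℕ}
    (h : monomial a (1 : K) ∈ J) (c : K) : monomial a c ∈ J := by
  have := J.mul_mem_left (C c) h
  rwa [C_mul_monomial, mul_one] at this

theorem mem_of_forall_monomial_mem {J : Ideal (MvPolynomial V K)} {f : MvPolynomial V K}
    (h : ∀ a ∈ f.support, monomial a (1 : K) ∈ J) : f ∈ J := by
  rw [f.as_sum]
  exact J.sum_mem fun a ha => monomial_mem_of_monomial_one_mem (h a ha) _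

theorem mul_monomial_mem_iff {J : Ideal (MvPolynomial V K)} (hJ : IsMonomialIdeal J)
    (f : MvPolynomial V K) (a : V →₀ ℕ) :
    f * monomial a (1 : K) ∈ J ↔ ∀ u ∈ f.support, monomial (u + a) (1 : K) ∈ J := by
  constructor
  · intro h u hu
    refine (hJ.mem_iff _).1 h _ ?_
    rw [mem_support_iff, coeff_mul_monomial, mul_one]
    exact mem_support_iff.1 hu
  · intro h
    rw [f.as_sum, Finset.sum_mul]
    refine J.sum_mem fun u hu => ?_
    rw [monomial_mul, mul_one]
    exact monomial_mem_of_monomial_one_mem (h u hu) _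

theorem support_sub_monomial_coeff_subset [DecidableEq V] (f : MvPolynomial V K) (d : V →₀ ℕ) :
    (f - monomial d (f.coeff d)).support ⊆ f.support.erase d := by
  intro u hu
  rw [mem_support_iff, coeff_sub, coeff_monomial] at hu
  rw [Finset.mem_erase, mem_support_iff]
  by_cases h : d = u
  · subst h
    simp at hu
  · rw [if_neg h, sub_zero] at hu
    exact ⟨Ne.symm h, hu⟩

theorem card_support_sub_monomial_coeff_lt {f : MvPolynomial V K} {d : V →₀ ℕ}
    (hd : d ∈ f.support) : (f - monomial d (f.coeff d)).support.card < f.support.card := by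
  classical
  refine (Finset.card_le_card (support_sub_monomial_coeff_subset f d)).trans_lt ?_
  exact Finset.card_erase_lt_of_mem hd

theorem mem_assPrimes_iff {R : Type*} [CommRing R] [IsNoetherianRing R] {J P : Ideal R} :
    P ∈ assPrimes J ↔ P.IsPrime ∧ ∃ g, ∀ f, f ∈ P ↔ f * g ∈ J := by
  rw [assPrimes, AssociatedPrimes.mem_iff, isAssociatedPrime_iff]
  refine and_congr_right fun _ => ?_
  have key : ∀ f g : R, f ∈ (⊥ : Submodule R (R ⧸ J)).colon {Ideal.Quotient.mk J g} ↔
      f * g ∈ J := by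
    intro f g
    rw [Submodule.mem_colon_singleton, Submodule.mem_bot, ← Ideal.Quotient.eq_zero_iff_mem]
    rfl
  constructor
  · rintro ⟨x, hx⟩
    obtain ⟨g, rfl⟩ := Ideal.Quotient.mk_surjective x
    exact ⟨g, fun f => by rw [hx, key]⟩
  · rintro ⟨g, hg⟩
    exact ⟨Ideal.Quotient.mk J g, by ext f; rw [hg, key]⟩

/-- Induction on the number of terms of `g`: terms are discarded without changing the colon until
the leading monomial alone can replace `g`. -/
theorem exists_monomial_of_colon [Finite V] {J P : Ideal (MvPolynomial V K)}
    (hJ : IsMonomialIdeal J) (hP : P.IsPrime) (g : MvPolynomial V K)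
    (hg : ∀ f, f ∈ P ↔ f * g ∈ J) : ∃ a, ∀ f, f ∈ P ↔ f * monomial a (1 : K) ∈ J := by
  classical
  induction hn : g.support.card using Nat.strong_induction_on generalizing g with
  | _ n ih =>
  subst hn
  by_cases h : ∃ u a, a ∈ g.support ∧ monomial (u + a) (1 : K) ∈ J ∧ monomial u (1 : K) ∉ P
  · obtain ⟨u, a, ha, hua, hu⟩ := h
    -- x^u sends the term at `a` into `J`; as x^u lies outside the prime `P`, multiplying `g` by it
    -- keeps the colon, and the term can be dropped.
    refine ih _ ?_ (monomial u 1 * (g - monomial a (g.coeff a))) ?_ rfl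
    · refine lt_of_le_of_lt ?_ (card_support_sub_monomial_coeff_lt ha)
      refine (Finset.card_le_card (support_mul _ _)).trans (Finset.card_add_le.trans ?_)
      simp [support_monomial]
    · intro f
      have h1 : f * (monomial u 1 * (g - monomial a (g.coeff a))) =
          f * monomial u 1 * g - f * monomial (u + a) (g.coeff a) := by
        rw [← one_mul (g.coeff a), ← monomial_mul, one_mul]
        ring
      rw [h1, Submodule.sub_mem_iff_left _
        (J.mul_mem_left _ (monomial_mem_of_monomial_one_mem hua _)), ← hg]
      exact ⟨fun hf => P.mul_mem_right _ hf, fun hf => (hP.mem_or_mem hf).resolve_right hu⟩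
  · push Not at h
    have hg0 : g ≠ 0 := by
      rintro rfl
      exact hP.ne_top ((Ideal.eq_top_iff_one _).2 ((hg 1).2 (by simp)))
    have : LinearOrder V := (Classical.choice (Finite.exists_equiv_fin V).choose_spec).linearOrder
    let mo : MonomialOrder V := MonomialOrder.lex
    -- Now any x^u sending some term of `g` into `J` lies in `P`. For `f` in `P`, the leading
    -- monomial of f·g lies in `J`, so the leading term of `f` lies in `P` and can be peeled off.
    refine ⟨mo.degree g, fun f => ⟨fun hf => ?_, fun hf => ?_⟩⟩
    · induction hm : f.support.card using Nat.strong_induction_on generalizing f with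
      | _ m ihf =>
      subst hm
      by_cases hf0 : f = 0
      · simp [hf0]
      have hd := mo.degree_mem_support hf0
      have hfg : f * g ∈ J := (hg f).1 hf
      have h1 : monomial (mo.degree f + mo.degree g) (1 : K) ∈ J := by
        refine (hJ.mem_iff _).1 hfg _ ?_
        rw [← mo.degree_mul hf0 hg0]
        exact mo.degree_mem_support (mul_ne_zero hf0 hg0)
      have h2 := h _ _ (mo.degree_mem_support hg0) h1
      have h3 := ihf _ (card_support_sub_monomial_coeff_lt hd) _
        (P.sub_mem hf (monomial_mem_of_monomial_one_mem h2 (f.coeff (mo.degree f)))) rfl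
      have h4 : monomial (mo.degree f) (f.coeff (mo.degree f)) * monomial (mo.degree g) (1 : K) ∈ J := by
        rw [monomial_mul, mul_one]
        exact monomial_mem_of_monomial_one_mem h1 _
      have := J.add_mem h3 h4
      rwa [← add_mul, sub_add_cancel] at this
    · rw [mul_monomial_mem_iff hJ] at hf
      exact mem_of_forall_monomial_mem fun u hu => h u _ (mo.degree_mem_support hg0) (hf u hu)

theorem IsMonomialIdeal.exists_monomial_of_mem_assPrimes [Finite V]
    {J P : Ideal (MvPolynomial V K)} (hJ : IsMonomialIdeal J) (hP : P ∈ assPrimes J) :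
    ∃ a, ∀ f, f ∈ P ↔ f * monomial a (1 : K) ∈ J := by
  obtain ⟨hP', g, hg⟩ := mem_assPrimes_iff.1 hP
  exact exists_monomial_of_colon hJ hP' g hg

theorem exists_X_mem_of_monomial_mem {P : Ideal (MvPolynomial V K)} (hP : P.IsPrime)
    {a : V →₀ ℕ} (ha : monomial a (1 : K) ∈ P) : ∃ v, a v ≠ 0 ∧ (X v : MvPolynomial V K) ∈ P := by
  rw [monomial_eq, C_1, one_mul, Finsupp.prod, hP.prod_mem_iff] at ha
  obtain ⟨v, hv, h⟩ := ha
  exact ⟨v, Finsupp.mem_support_iff.1 hv, hP.mem_of_pow_mem _ h⟩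

theorem eq_span_X_of_colon {J P : Ideal (MvPolynomial V K)} (hJ : IsMonomialIdeal J)
    (hP : P.IsPrime) {a : V →₀ ℕ} (ha : ∀ f, f ∈ P ↔ f * monomial a (1 : K) ∈ J) :
    P = Ideal.span (X '' {v | (X v : MvPolynomial V K) ∈ P}) := by
  apply le_antisymm
  · intro f hf
    rw [mem_ideal_span_X_image]
    intro m hm
    have h1 := (mul_monomial_mem_iff hJ f a).1 ((ha f).1 hf) m hm
    have h2 : monomial m (1 : K) ∈ P := by
      rw [ha, monomial_mul, one_mul]
      exact h1
    obtain ⟨v, hv, hvP⟩ := exists_X_mem_of_monomial_mem hP h2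
    exact ⟨v, hvP, hv⟩
  · rw [Ideal.span_le]
    rintro _ ⟨v, hv, rfl⟩
    exact hv

/-- The ideal is the kernel of the substitution sending the variables of `U` to 0. This substitution
is the identity modulo the ideal, and its target is a domain. -/
theorem isPrime_span_X_image (U : Set V) :
    (Ideal.span (X '' U) : Ideal (MvPolynomial V K)).IsPrime := by
  classical
  let φ : MvPolynomial V K →ₐ[K] MvPolynomial V K := aeval fun v => if v ∈ U then 0 else X v
  have h1 : (Ideal.span (X '' U) : Ideal (MvPolynomial V K)) = RingHom.ker φ := by
    apply le_antisymm
    · rw [Ideal.span_le]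
      rintro _ ⟨v, hv, rfl⟩
      simp [φ, hv, RingHom.mem_ker]
    · intro f hf
      have h2 : (Ideal.Quotient.mkₐ K (Ideal.span (X '' U))).comp φ =
          Ideal.Quotient.mkₐ K (Ideal.span (X '' U)) := by
        ext v
        by_cases hv : v ∈ U
        · have : (X v : MvPolynomial V K) ∈ Ideal.span (X '' U) :=
            Ideal.subset_span ⟨v, hv, rfl⟩
          simp [φ, hv, Ideal.Quotient.eq_zero_iff_mem.2 this]
        · simp [φ, hv]
      have h3 := DFunLike.congr_fun h2 f
      rw [AlgHom.comp_apply, (RingHom.mem_ker).1 hf, map_zero] at h3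
      exact Ideal.Quotient.eq_zero_iff_mem.1 h3.symm
  rw [h1]
  exact RingHom.ker_isPrime _

theorem X_mem_span_X_image {U : Set V} {v : V} :
    (X v : MvPolynomial V K) ∈ (Ideal.span (X '' U) : Ideal (MvPolynomial V K)) ↔ v ∈ U := by
  classical
  rw [mem_ideal_span_X_image]
  simp [support_X, Finsupp.single_apply]

theorem isMonomialIdeal_span_X_image (U : Set V) :
    IsMonomialIdeal (Ideal.span (X '' U) : Ideal (MvPolynomial V K)) :=
  ⟨(fun v => Finsupp.single v 1) '' U, by rw [Set.image_image]; rfl⟩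

theorem idealOfVars_eq_span_X_image :
    idealOfVars V K = Ideal.span (X '' (Set.univ : Set V)) := by
  rw [Set.image_univ]

/-- For a monomial ideal the colon by x^a can be tested on monomials: those in the variables outside
`U` must not send x^a into `J`. -/
theorem span_X_image_mem_assPrimes [Finite V] {J : Ideal (MvPolynomial V K)}
    (hJ : IsMonomialIdeal J) (U : Set V) (a : V →₀ ℕ)
    (h1 : ∀ v ∈ U, monomial (Finsupp.single v 1 + a) (1 : K) ∈ J)
    (h2 : ∀ u : V →₀ ℕ, (∀ v ∈ U, u v = 0) → monomial (u + a) (1 : K) ∉ J) :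
    Ideal.span (X '' U) ∈ assPrimes J := by
  refine mem_assPrimes_iff.2 ⟨isPrime_span_X_image U, monomial a 1, fun f => ⟨fun hf => ?_,
    fun hf => ?_⟩⟩
  · have : Ideal.span (X '' U) ≤ Submodule.colon J {monomial a (1 : K)} := by
      rw [Ideal.span_le]
      rintro _ ⟨v, hv, rfl⟩
      refine Submodule.mem_colon_singleton.2 ?_
      rw [smul_eq_mul, X, monomial_mul, one_mul]
      exact h1 v hv
    exact Submodule.mem_colon_singleton.1 (this hf)
  · rw [mem_ideal_span_X_image]
    intro m hm
    by_contra! hcon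
    exact h2 m hcon ((mul_monomial_mem_iff hJ f a).1 hf m hm)

end MonomialIdeals

/-! ### Powers and minimal primes of edge ideals -/

section EdgeIdeals

variable {K : Type*} [Field K] {V : Type*} {G : SimpleGraph V}

theorem edgeIdeal_pow_eq (G : SimpleGraph V) (m : ℕ) : edgeIdeal K G ^ m =
    Ideal.span ((fun a => monomial a (1 : K)) '' {c | ∃ s : Multiset (V →₀ ℕ), s.card = m ∧
      (∀ e ∈ s, ∃ i j, G.Adj i j ∧ e = Finsupp.single i 1 + Finsupp.single j 1) ∧ s.sum = c}) := by
  induction m with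
  | zero =>
    rw [pow_zero, Ideal.one_eq_top, eq_comm, Ideal.eq_top_iff_one]
    exact Ideal.subset_span ⟨0, ⟨0, by simp⟩, by simp⟩
  | succ m ih =>
    rw [pow_succ, ih, edgeIdeal, Ideal.span_mul_span']
    congr 1
    ext f
    simp only [Set.mem_mul, Set.mem_image, Set.mem_ofPred_eq]
    constructor
    · rintro ⟨_, ⟨c, ⟨s, hs, hs', rfl⟩, rfl⟩, _, ⟨i, j, hij, rfl⟩, rfl⟩
      refine ⟨_, ⟨(Finsupp.single i 1 + Finsupp.single j 1) ::ₘ s, by simp [hs], ?_, rfl⟩, ?_⟩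
      · intro e he
        rcases Multiset.mem_cons.1 he with rfl | he
        · exact ⟨i, j, hij, rfl⟩
        · exact hs' e he
      · rw [Multiset.sum_cons, X, X, monomial_mul, monomial_mul, one_mul, one_mul, add_comm]
    · rintro ⟨_, ⟨s, hs, hs', rfl⟩, rfl⟩
      obtain ⟨e, he⟩ := Multiset.card_pos_iff_exists_mem.1 (show 0 < s.card by omega)
      obtain ⟨t, rfl⟩ := Multiset.exists_cons_of_mem he
      have ht : t.card = m := by simpa using hs
      obtain ⟨i, j, hij, rfl⟩ := hs' e (Multiset.mem_cons_self _ _)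
      refine ⟨_, ⟨_, ⟨t, ht, fun e he => hs' e (Multiset.mem_cons_of_mem he), rfl⟩, rfl⟩, _,
        ⟨i, j, hij, rfl⟩, ?_⟩
      rw [Multiset.sum_cons, X, X, monomial_mul, monomial_mul, one_mul, one_mul, add_comm]

theorem isMonomialIdeal_edgeIdeal_pow (G : SimpleGraph V) (m : ℕ) :
    IsMonomialIdeal (edgeIdeal K G ^ m) := ⟨_, edgeIdeal_pow_eq G m⟩

theorem isMonomialIdeal_edgeIdeal (G : SimpleGraph V) : IsMonomialIdeal (edgeIdeal K G) := by
  simpa using isMonomialIdeal_edgeIdeal_pow (K := K) G 1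

theorem monomial_mem_edgeIdeal_pow {m : ℕ} {b : V →₀ ℕ} :
    monomial b (1 : K) ∈ edgeIdeal K G ^ m ↔ Packs G m b := by
  classical
  rw [edgeIdeal_pow_eq, mem_ideal_span_monomial_image]
  simp only [support_monomial, one_ne_zero, if_false, Finset.mem_singleton, forall_eq,
    Set.mem_ofPred_eq, Packs]
  constructor
  · rintro ⟨_, ⟨s, h1, h2, rfl⟩, h3⟩
    exact ⟨s, h1, h2, h3⟩
  · rintro ⟨s, h1, h2, h3⟩
    exact ⟨_, ⟨s, h1, h2, rfl⟩, h3⟩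

theorem edgeIdeal_le_iff {P : Ideal (MvPolynomial V K)} (hP : P.IsPrime) :
    edgeIdeal K G ≤ P ↔ ∀ i j, G.Adj i j →
      (X i : MvPolynomial V K) ∈ P ∨ (X j : MvPolynomial V K) ∈ P := by
  rw [edgeIdeal, Ideal.span_le]
  constructor
  · intro h i j hij
    exact hP.mem_or_mem (h ⟨i, j, hij, rfl⟩)
  · rintro h _ ⟨i, j, hij, rfl⟩
    rcases h i j hij with h | h
    · exact P.mul_mem_right _ h
    · exact P.mul_mem_left _ h

theorem edgeIdeal_le_of_mem_assPrimes {P : Ideal (MvPolynomial V K)} {m : ℕ}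
    (hP : P ∈ assPrimes (edgeIdeal K G ^ m)) : edgeIdeal K G ≤ P := by
  have h1 : P.IsPrime := IsAssociatedPrime.isPrime hP
  have h2 := IsAssociatedPrime.annihilator_le hP
  rw [Submodule.annihilator_top, Ideal.annihilator_quotient] at h2
  exact h1.le_of_pow_le h2

theorem minimalPrimes_subset_assPrimes_pow [Finite V] {I : Ideal (MvPolynomial V K)} {m : ℕ}
    (hm : m ≠ 0) : I.minimalPrimes ⊆ assPrimes (I ^ m) := by
  have h1 := Module.associatedPrimes.minimalPrimes_annihilator_subset_associatedPrimes (MvPolynomial V K)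
    (MvPolynomial V K ⧸ I ^ m)
  rw [Ideal.annihilator_quotient, ← Ideal.radical_minimalPrimes, Ideal.radical_pow _ hm,
    Ideal.radical_minimalPrimes] at h1
  exact h1

/-- A prime generated by a minimal vertex cover is a minimal prime of the edge ideal. -/
theorem span_X_image_mem_minimalPrimes {U : Set V}
    (hU : ∀ i j, G.Adj i j → i ∈ U ∨ j ∈ U)
    (hmin : ∀ U' ⊆ U, (∀ i j, G.Adj i j → i ∈ U' ∨ j ∈ U') → U ⊆ U') :
    Ideal.span (X '' U) ∈ (edgeIdeal K G).minimalPrimes := by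
  refine ⟨⟨isPrime_span_X_image U, ?_⟩, fun Q ⟨hQ, hIQ⟩ hQU => ?_⟩
  · rw [edgeIdeal_le_iff (isPrime_span_X_image U)]
    simpa only [X_mem_span_X_image] using hU
  · have h1 := hmin {v | (X v : MvPolynomial V K) ∈ Q}
      (fun v hv => X_mem_span_X_image.1 (hQU hv)) ((edgeIdeal_le_iff hQ).1 hIQ)
    rw [Ideal.span_le]
    rintro _ ⟨v, hv, rfl⟩
    exact h1 hv

end EdgeIdeals

/-! ### Packings along odd closed walks -/

section Packing

variable {V : Type*} {G : SimpleGraph V}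

theorem Packs.nsmul {m : ℕ} {b : V →₀ ℕ} (h : Packs G m b) (s : ℕ) : Packs G (s * m) (s • b) := by
  induction s with
  | zero => simpa using Packs.zero _
  | succ s ih =>
    rw [add_mul, one_mul, add_smul, one_smul]
    exact ih.add h

theorem Packs.le_sum_of_cover {m : ℕ} {b : V →₀ ℕ} (h : Packs G m b) (C : Finset V)
    (hC : ∀ i j, G.Adj i j → i ∈ C ∨ j ∈ C) : m ≤ ∑ v ∈ C, b v := by
  classical
  have := h.mul_le_sum C 1 fun i j hij _ _ => by
    rcases hC i j hij with h | h <;> simp [h]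
  rwa [one_mul] at this

/-- If `m + 1` edges can be packed into `b` with one more copy of `v`, then either `v` is not needed
or removing the edge at `v` frees a copy of a neighbour of `v`. -/
theorem Packs.of_single_add {m : ℕ} {v : V} {b : V →₀ ℕ}
    (h : Packs G (m + 1) (Finsupp.single v 1 + b)) :
    Packs G (m + 1) b ∨ ∃ w b', G.Adj v w ∧ Packs G m b' ∧ b' + Finsupp.single w 1 ≤ b := by
  classical
  obtain ⟨s, h1, h2, h3⟩ := h
  by_cases hv : ∃ e ∈ s, e v ≠ 0
  · right
    obtain ⟨e, he, hev⟩ := hv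
    obtain ⟨t, rfl⟩ := Multiset.exists_cons_of_mem he
    have ht : Packs G m t.sum :=
      ⟨t, by simpa using h1, fun e he => h2 e (Multiset.mem_cons_of_mem he), le_rfl⟩
    obtain ⟨w, hw, hew⟩ : ∃ w, G.Adj v w ∧ e = Finsupp.single v 1 + Finsupp.single w 1 := by
      obtain ⟨i, j, hij, rfl⟩ := h2 e he
      by_cases hi : i = v
      · subst hi
        exact ⟨j, hij, rfl⟩
      · have hj : j = v := by
          by_contra hj
          simp [hi, hj] at hev
        subst hj
        exact ⟨i, hij.symm, add_comm _ _⟩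
    refine ⟨w, _, hw, ht, ?_⟩
    rw [Multiset.sum_cons, hew, add_assoc] at h3
    rw [add_comm]
    exact le_of_add_le_add_left h3
  · left
    push Not at hv
    refine ⟨s, h1, h2, fun x => ?_⟩
    by_cases hx : v = x
    · subst hx
      have : Finsupp.applyAddHom v s.sum = 0 := by
        rw [map_multiset_sum]
        refine Multiset.sum_eq_zero fun n hn => ?_
        obtain ⟨e, he, rfl⟩ := Multiset.mem_map.1 hn
        exact hv e he
      have h4 : s.sum v = 0 := this
      rw [h4]
      exact Nat.zero_le _
    · have := h3 x
      simpa [Finsupp.single_apply, hx] using this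

theorem sum_map_single_apply_le (l : List V) (T : Finset V) :
    ∑ v ∈ T, (l.map fun x => Finsupp.single x 1).sum v ≤ l.length := by
  classical
  induction l with
  | nil => simp
  | cons x l ih =>
    simp only [List.map_cons, List.sum_cons, Finsupp.add_apply, Finset.sum_add_distrib,
      List.length_cons, Finsupp.single_apply, Finset.sum_ite_eq]
    split_ifs <;> omega

theorem mem_of_sum_map_single_apply_ne_zero {l : List V} {v : V}
    (h : (l.map fun x => Finsupp.single x 1).sum v ≠ 0) : v ∈ l := by
  classical
  induction l with
  | nil => simp at h
  | cons x l ih =>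
    by_cases hx : x = v
    · simp [hx]
    · simp only [List.map_cons, List.sum_cons, Finsupp.add_apply, Finsupp.single_apply, hx,
        if_false, zero_add] at h
      exact List.mem_cons_of_mem _ (ih h)

theorem packs_closed_walk {u : V} {c : G.Walk u u} {r : ℕ} (hc : c.length = 2 * r + 1) :
    Packs G r (c.support.tail.map fun x => Finsupp.single x 1).sum := by
  have hn : ¬ c.Nil := by
    rw [SimpleGraph.Walk.not_nil_iff_lt_length]
    omega
  have h1 := Packs.of_walk c.tail
  have h2 := SimpleGraph.Walk.length_tail_add_one hn
  rw [SimpleGraph.Walk.support_tail_of_not_nil _ hn] at h1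
  exact h1.mono_left (by omega)

/-- A vertex on the walk is itself adjacent to its successor, so V(C) ∪ N(C) is just N(C). -/
theorem exists_adj_mem_support {u : V} {c : G.Walk u u} (hc : ¬ c.Nil) {v : V}
    (hv : v ∈ {v | v ∈ c.support} ∪ nbrs G {v | v ∈ c.support}) :
    ∃ w ∈ c.support, G.Adj w v := by
  classical
  rcases hv with hv | ⟨w, hw, hwv⟩
  · have hn : ¬ (c.rotate v hv).Nil := by simpa using hc
    refine ⟨_, ?_, ((c.rotate v hv).adj_snd hn).symm⟩
    rw [← SimpleGraph.Walk.mem_support_rotate_iff c v hv]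
    exact SimpleGraph.Walk.getVert_mem_support _ _
  · exact ⟨w, hw, hwv⟩

/-- Going once around from the successor of a neighbour `w` of `v` back to `w`, then on to `v`,
visits 2r + 2 vertices, which pair off into consecutive edges. The tail of the support drops the
repeated base point. -/
theorem packs_single_add_closed_walk {u : V} {c : G.Walk u u} {r : ℕ}
    (hc : c.length = 2 * r + 1) {v : V}
    (hv : v ∈ {v | v ∈ c.support} ∪ nbrs G {v | v ∈ c.support}) :
    Packs G (r + 1)
      (Finsupp.single v 1 + (c.support.tail.map fun x => Finsupp.single x 1).sum) := by
  classical
  have hn : ¬ c.Nil := by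
    rw [SimpleGraph.Walk.not_nil_iff_lt_length]
    omega
  obtain ⟨w, hw, hwv⟩ := exists_adj_mem_support hn hv
  have hn' : ¬ (c.rotate w hw).Nil := by simpa using hn
  have h1 := Packs.of_walk ((c.rotate w hw).tail.concat hwv)
  have h2 := SimpleGraph.Walk.length_tail_add_one hn'
  rw [SimpleGraph.Walk.length_rotate] at h2
  have h3 := ((SimpleGraph.Walk.support_rotate c w hw).perm.map
    fun x => (Finsupp.single x 1 : V →₀ ℕ)).sum_eq
  rw [SimpleGraph.Walk.support_concat, SimpleGraph.Walk.support_tail_of_not_nil _ hn',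
    List.map_append, List.sum_append, h3] at h1
  refine (h1.mono_left ?_).mono_right (le_of_eq ?_)
  · simp only [SimpleGraph.Walk.length_concat]
    omega
  · simp [add_comm]

theorem support_subset_of_forall_adj {S : Set V} (hS : ∀ x y, G.Adj x y → y ∈ S) {u v : V}
    (w : G.Walk u v) (hu : u ∈ S) : ∀ x ∈ w.support, x ∈ S := by
  induction w with
  | nil => simpa using hu
  | cons h p ih =>
    intro x hx
    rw [SimpleGraph.Walk.support_cons, List.mem_cons] at hx
    rcases hx with rfl | hx
    · exact hu
    · exact ih (hS _ _ h) x hx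

end Packing

/-! ### Covering arguments -/

section Covers

variable {V : Type*} [Fintype V] {G : SimpleGraph V}

/-- The variables of a proper monomial prime associated to a power of the edge ideal form a minimal
vertex cover when all odd cycles are dominating. -/
theorem minimal_cover_of_packs (hdom : OddCyclesDominating G) {m : ℕ} (a : V →₀ ℕ)
    {U : Set V} (hU : U ≠ Set.univ) (hcov : ∀ i j, G.Adj i j → i ∈ U ∨ j ∈ U)
    (h1 : ∀ v ∈ U, Packs G m (Finsupp.single v 1 + a))
    (h2 : ∀ u : V →₀ ℕ, (∀ v ∈ U, u v = 0) → ¬ Packs G m (u + a))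
    (U' : Set V) (hU'U : U' ⊆ U) (hU' : ∀ i j, G.Adj i j → i ∈ U' ∨ j ∈ U') : U ⊆ U' := by
  classical
  obtain ⟨y, hy⟩ := (Set.ne_univ_iff_exists_notMem U).1 hU
  let L : Set V := {v | v ∈ U ∧ ∃ y, y ∉ U ∧ G.Adj v y}
  let R : Set V := U \ L
  let G' : SimpleGraph V :=
    { Adj := fun u v => G.Adj u v ∧ u ∈ R ∧ v ∈ R
      symm := ⟨fun u v h => ⟨h.1.symm, h.2.2, h.2.1⟩⟩
      loopless := ⟨fun u h => G.loopless.irrefl u h.1⟩ }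
  have hG' : G' ≤ G := fun u v h => h.1
  obtain ⟨A, hA⟩ : ∃ A : Set V, ∀ u v, G'.Adj u v → (u ∈ A ↔ v ∉ A) := by
    refine exists_bipartition_of_forall_cycle_not_odd fun x c hc hodd => ?_
    have hx : x ∈ R := (c.adj_snd hc.not_nil).2.1
    have hR := support_subset_of_forall_adj (G := G') (S := R) (fun x y h => h.2.2) c hx
    have h3 := hdom x (c.mapLe hG') (hc.mapLe hG') (by simpa using hodd)
    have hy' : y ∈ (Set.univ : Set V) := trivial
    rw [← h3, SimpleGraph.Walk.support_mapLe_eq_support] at hy'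
    rcases hy' with hy' | ⟨s, hs, hsy⟩
    · exact hy (hR y hy').1
    · exact (hR s hs).2 ⟨(hR s hs).1, y, hy, hsy⟩
  -- Edges inside `L`, or between `L` and `R`, are left out to keep `H` bipartite; they are covered
  -- anyway once the cover contains `L`.
  let H : SimpleGraph V :=
    { Adj := fun u v => G.Adj u v ∧ ((u ∈ R ∧ v ∈ R) ∨ (u ∈ L ∧ v ∉ U) ∨ (u ∉ U ∧ v ∈ L))
      symm := ⟨fun u v h => ⟨h.1.symm, by tauto⟩⟩
      loopless := ⟨fun u h => G.loopless.irrefl u h.1⟩ }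
  have hH : H ≤ G := fun u v h => h.1
  have hLU : ∀ v ∈ L, v ∈ U := fun v hv => hv.1
  have hRU : ∀ v ∈ R, v ∈ U := fun v hv => hv.1
  have hRL : ∀ v ∈ R, v ∉ L := fun v hv => hv.2
  have hbip : ∀ u v, H.Adj u v →
      (u ∈ {v | (v ∈ R ∧ v ∈ A) ∨ v ∈ L} ↔ v ∉ {v | (v ∈ R ∧ v ∈ A) ∨ v ∈ L}) := by
    rintro u v ⟨huv, ⟨hu, hv⟩ | ⟨hu, hv⟩ | ⟨hu, hv⟩⟩
    · have h3 := hA u v ⟨huv, hu, hv⟩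
      have h4 := hRL u hu
      have h5 := hRL v hv
      simp only [Set.mem_ofPred_eq]
      tauto
    · have h3 : v ∉ R := fun h => hv (hRU v h)
      have h4 : v ∉ L := fun h => hv (hLU v h)
      simp only [Set.mem_ofPred_eq]
      tauto
    · have h3 : u ∉ R := fun h => hu (hRU u h)
      have h4 : u ∉ L := fun h => hu (hLU u h)
      simp only [Set.mem_ofPred_eq]
      tauto
  -- Weight `m` outside `U` is too heavy for a cover of weight below `m`, so the cover given by
  -- duality lies inside `U` and therefore contains `L`.
  let u0 : V →₀ ℕ := Finsupp.equivFunOnFinite.symm fun v => if v ∈ U then 0 else m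
  obtain ⟨C, hC, hCp⟩ := exists_cover_packs H _ hbip (u0 + a)
  have hlt : ∑ v ∈ C, (u0 + a) v < m := by
    by_contra! h
    exact h2 u0 (fun v hv => by simp [u0, hv]) ((hCp.mono_graph hH).mono_left h)
  have hCU : ∀ v ∈ C, v ∈ U := by
    intro v hv
    by_contra hvU
    have h3 : (u0 + a) v ≤ ∑ v ∈ C, (u0 + a) v :=
      Finset.single_le_sum (f := fun v => (u0 + a) v) (fun _ _ => Nat.zero_le _) hv
    simp only [Finsupp.add_apply, u0, Finsupp.equivFunOnFinite_symm_apply_apply, hvU,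
      if_false] at h3 hlt
    omega
  have hsum : ∑ v ∈ C, a v < m :=
    (Finset.sum_le_sum fun v _ => by simp).trans_lt hlt
  have hCL : ∀ v ∈ L, v ∈ C := by
    rintro v ⟨hv, y, hy, hvy⟩
    rcases hC v y ⟨hvy, Or.inr (Or.inl ⟨⟨hv, y, hy, hvy⟩, hy⟩)⟩ with h | h
    · exact h
    · exact absurd (hCU y h) hy
  have hCG : ∀ i j, G.Adj i j → i ∈ C ∨ j ∈ C := by
    intro i j hij
    by_cases hi : i ∈ L
    · exact Or.inl (hCL i hi)
    by_cases hj : j ∈ L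
    · exact Or.inr (hCL j hj)
    have hiU : i ∈ U := by
      by_contra hiU
      have hjU := (hcov i j hij).resolve_left hiU
      exact hj ⟨hjU, i, hiU, hij.symm⟩
    have hjU : j ∈ U := by
      by_contra hjU
      exact hi ⟨hiU, j, hjU, hij⟩
    exact hC i j ⟨hij, Or.inl ⟨⟨hiU, hi⟩, ⟨hjU, hj⟩⟩⟩
  -- If `C'` missed `v`, packing `m` edges into a + v would need weight `m` on `C'`, where `a` has
  -- less.
  have key : ∀ C' ⊆ C, (∀ i j, G.Adj i j → i ∈ C' ∨ j ∈ C') → ∀ v ∈ U, v ∈ C' := by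
    intro C' hC' hcov' v hv
    by_contra hvC
    have h3 := (h1 v hv).le_sum_of_cover C' hcov'
    have h4 : ∑ x ∈ C', (Finsupp.single v 1 + a : V →₀ ℕ) x = ∑ x ∈ C', a x := by
      refine Finset.sum_congr rfl fun x hx => ?_
      have : v ≠ x := fun h => hvC (h ▸ hx)
      simp [this]
    have h5 := Finset.sum_le_sum_of_subset (f := fun v => a v) hC'
    omega
  have hUC := key C subset_rfl hCG
  intro v hv
  have h3 := key (C.filter (· ∈ U')) (Finset.filter_subset _ _) (fun i j hij => by
    rcases hU' i j hij with h | h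
    · exact Or.inl (Finset.mem_filter.2 ⟨hUC _ (hU'U h), h⟩)
    · exact Or.inr (Finset.mem_filter.2 ⟨hUC _ (hU'U h), h⟩)) v hv
  exact (Finset.mem_filter.1 h3).2

/-- Below the odd girth, the irrelevant ideal is not associated to powers of the edge ideal. -/
theorem not_forall_packs_single_add [Nonempty V] {k m : ℕ}
    (hk : ∀ j, HasCycleOfLength G (2 * j + 1) → k ≤ j) (hm : m + 1 ≤ k) (a : V →₀ ℕ)
    (h0 : ¬ Packs G (m + 1) a) (h1 : ∀ v, Packs G (m + 1) (Finsupp.single v 1 + a)) : False := by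
  classical
  have step : ∀ v, ∃ w b', G.Adj v w ∧ Packs G m b' ∧ b' + Finsupp.single w 1 ≤ a :=
    fun v => (h1 v).of_single_add.resolve_left h0
  obtain ⟨w₁, b₁, -, ⟨s₁, hc₁, hs₁, hb₁⟩, ha₁⟩ := step (Classical.arbitrary V)
  -- Applying `step` to `w₁` makes `w₁` and `w₂` adjacent, so a cover must contain one of them.
  obtain ⟨w₂, b₂, hw, ⟨s₂, hc₂, hs₂, hb₂⟩, ha₂⟩ := step w₁
  have hp : ∀ e : V →₀ ℕ, ∃ p : V × V, e ∈ s₁ + s₂ →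
      G.Adj p.1 p.2 ∧ e = Finsupp.single p.1 1 + Finsupp.single p.2 1 := by
    intro e
    by_cases he : e ∈ s₁ + s₂
    · rcases Multiset.mem_add.1 he with h | h
      · obtain ⟨i, j, h⟩ := hs₁ e h
        exact ⟨(i, j), fun _ => h⟩
      · obtain ⟨i, j, h⟩ := hs₂ e h
        exact ⟨(i, j), fun _ => h⟩
    · exact ⟨(w₁, w₁), fun h => absurd h he⟩
  choose p hp using hp
  let E : Finset (Sym2 V) :=
    insert s(w₁, w₂) ((s₁ + s₂).toFinset.image fun e => s((p e).1, (p e).2))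
  -- Two packings of `m` edges and the edge w₁w₂: fewer than the 2k + 1 edges of a shortest odd
  -- cycle.
  have hE : E.card ≤ 2 * m + 1 := by
    refine (Finset.card_insert_le _ _).trans ?_
    have h3 := Multiset.toFinset_card_le (s₁ + s₂)
    have h4 : ((s₁ + s₂).toFinset.image fun e => s((p e).1, (p e).2)).card ≤
      (s₁ + s₂).toFinset.card := Finset.card_image_le
    rw [Multiset.card_add, hc₁, hc₂] at h3
    omega
  let H : SimpleGraph V := SimpleGraph.fromEdgeSet (E : Set (Sym2 V))
  have hHG : H ≤ G := by
    intro x y hxy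
    have h3 : s(x, y) ∈ E := by simpa using ((SimpleGraph.fromEdgeSet_adj _).1 hxy).1
    rw [← SimpleGraph.mem_edgeSet]
    rcases Finset.mem_insert.1 h3 with h3 | h3
    · rw [h3]
      exact hw
    · obtain ⟨e, he, h3⟩ := Finset.mem_image.1 h3
      rw [← h3]
      exact (hp e (by simpa using he)).1
  have hHw : H.Adj w₁ w₂ := by
    rw [SimpleGraph.fromEdgeSet_adj]
    exact ⟨by simp [E], hw.ne⟩
  have hHp : ∀ e ∈ s₁ + s₂, ∃ i j, H.Adj i j ∧ e = Finsupp.single i 1 + Finsupp.single j 1 := by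
    intro e he
    refine ⟨_, _, ?_, (hp e he).2⟩
    rw [SimpleGraph.fromEdgeSet_adj]
    refine ⟨?_, (hp e he).1.ne⟩
    exact Finset.mem_coe.2 (Finset.mem_insert_of_mem
      (Finset.mem_image.2 ⟨e, Multiset.mem_toFinset.2 he, rfl⟩))
  obtain ⟨A, hA⟩ : ∃ A : Set V, ∀ u v, H.Adj u v → (u ∈ A ↔ v ∉ A) := by
    refine exists_bipartition_of_forall_cycle_not_odd fun x c hc ⟨j, hj⟩ => ?_
    have h3 := hk j ⟨x, c.mapLe hHG, hc.mapLe hHG, by simpa using hj⟩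
    have h4 := hc.isTrail.length_le_card_edgeFinset
    have h5 : H.edgeFinset ⊆ E := by
      intro e he
      rw [SimpleGraph.mem_edgeFinset, SimpleGraph.edgeSet_fromEdgeSet] at he
      exact he.1
    have h6 := Finset.card_le_card h5
    omega
  obtain ⟨C, hC, hCp⟩ := exists_cover_packs H A hA a
  have hlt : ∑ v ∈ C, a v < m + 1 := by
    by_contra! h
    exact h0 ((hCp.mono_graph hHG).mono_left h)
  -- The `m` packed edges and the spare copy of `w` would together put weight m + 1 on `C`.
  have hnot : ∀ (w : V) (b' : V →₀ ℕ), Packs H m b' → b' + Finsupp.single w 1 ≤ a → w ∉ C := by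
    intro w b' hb' hle hwC
    have h3 := hb'.le_sum_of_cover C hC
    have h4 : ∑ v ∈ C, (b' + Finsupp.single w 1 : V →₀ ℕ) v ≤ ∑ v ∈ C, a v :=
      Finset.sum_le_sum fun v _ => hle v
    simp only [Finsupp.add_apply, Finset.sum_add_distrib, Finsupp.single_apply,
      Finset.sum_ite_eq, hwC, if_true] at h4
    omega
  rcases hC w₁ w₂ hHw with h | h
  · exact hnot w₁ b₁ ⟨s₁, hc₁, fun e he => hHp e (Multiset.mem_add.2 (Or.inl he)), hb₁⟩ ha₁ h
  · exact hnot w₂ b₂ ⟨s₂, hc₂, fun e he => hHp e (Multiset.mem_add.2 (Or.inr he)), hb₂⟩ ha₂ h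

end Covers

/-! ### Associated and persistent primes of powers -/

section AssociatedPrimes

variable {K : Type*} [Field K] {V : Type*} {G : SimpleGraph V}

theorem monomial_mem_iff_packs {P : Ideal (MvPolynomial V K)} {m : ℕ} {a : V →₀ ℕ}
    (ha : ∀ f, f ∈ P ↔ f * monomial a (1 : K) ∈ edgeIdeal K G ^ m) (u : V →₀ ℕ) :
    monomial u (1 : K) ∈ P ↔ Packs G m (u + a) := by
  rw [ha, monomial_mul, one_mul, monomial_mem_edgeIdeal_pow]

/-- An associated prime of a power of the edge ideal which misses an end of some edge
remains associated to the next power. -/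
theorem mem_assPrimes_succ_of_adj [Finite V] {P : Ideal (MvPolynomial V K)} {m : ℕ}
    (hP : P ∈ assPrimes (edgeIdeal K G ^ m)) {x y : V} (hxy : G.Adj x y)
    (hy : (X y : MvPolynomial V K) ∉ P) :
    P ∈ assPrimes (edgeIdeal K G ^ (m + 1)) := by
  have hJ := isMonomialIdeal_edgeIdeal_pow (K := K) G m
  have hprime := (mem_assPrimes_iff.1 hP).1
  obtain ⟨a, ha⟩ := hJ.exists_monomial_of_mem_assPrimes hP
  rw [eq_span_X_of_colon hJ hprime ha]
  refine span_X_image_mem_assPrimes (isMonomialIdeal_edgeIdeal_pow G _) _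
    -- The witness is multiplied by the edge xy. Removing one copy of `x` costs at most one packed
    -- edge, and the remaining factor `y` is harmless as it lies outside `P`.
    (a + (Finsupp.single x 1 + Finsupp.single y 1)) ?_ ?_
  · intro v hv
    rw [monomial_mem_edgeIdeal_pow, ← add_assoc]
    exact ((monomial_mem_iff_packs ha _).1 hv).add (Packs.edge hxy)
  · intro u hu h
    rw [monomial_mem_edgeIdeal_pow] at h
    have h1 : Packs G m (u + Finsupp.single y 1 + a) := by
      have h2 : u + (a + (Finsupp.single x 1 + Finsupp.single y 1)) =
          Finsupp.single x 1 + (u + Finsupp.single y 1 + a) := by abel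
      rw [h2] at h
      rcases h.of_single_add with h | ⟨w, b', -, hb', hle⟩
      · exact h.mono_left (Nat.le_succ m)
      · exact hb'.mono_right (le_self_add.trans hle)
    obtain ⟨v, hv, hvP⟩ := exists_X_mem_of_monomial_mem hprime ((monomial_mem_iff_packs ha _).2 h1)
    have hvy : y ≠ v := fun h => hy (h ▸ hvP)
    simp [hu v hvP, hvy] at hv

variable [Fintype V]

theorem eq_idealOfVars_or_mem_minimalPrimes (hdom : OddCyclesDominating G) {m : ℕ}
    {P : Ideal (MvPolynomial V K)} (hP : P ∈ assPrimes (edgeIdeal K G ^ m)) :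
    P = idealOfVars V K ∨ P ∈ (edgeIdeal K G).minimalPrimes := by
  have hJ := isMonomialIdeal_edgeIdeal_pow (K := K) G m
  have hprime := (mem_assPrimes_iff.1 hP).1
  obtain ⟨a, ha⟩ := hJ.exists_monomial_of_mem_assPrimes hP
  have hspan := eq_span_X_of_colon hJ hprime ha
  by_cases hU : {v | (X v : MvPolynomial V K) ∈ P} = Set.univ
  · left
    rw [hspan, hU, idealOfVars_eq_span_X_image]
  · right
    have hcov := (edgeIdeal_le_iff hprime).1 (edgeIdeal_le_of_mem_assPrimes hP)
    rw [hspan]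
    refine span_X_image_mem_minimalPrimes hcov ?_
    refine minimal_cover_of_packs hdom (m := m) a hU hcov
      (fun v hv => (monomial_mem_iff_packs ha _).1 hv) fun u hu h => ?_
    obtain ⟨v, hv, hvP⟩ := exists_X_mem_of_monomial_mem hprime ((monomial_mem_iff_packs ha _).2 h)
    exact hv (hu v hvP)

theorem idealOfVars_notMem_assPrimes [Nonempty V] {k m : ℕ}
    (hk : ∀ j, HasCycleOfLength G (2 * j + 1) → k ≤ j) (hm : 1 ≤ m) (hmk : m ≤ k) :
    idealOfVars V K ∉ assPrimes (edgeIdeal K G ^ m) := by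
  intro hP
  obtain ⟨m, rfl⟩ := Nat.exists_eq_add_of_le' hm
  obtain ⟨a, ha⟩ :=
    (isMonomialIdeal_edgeIdeal_pow (K := K) G (m + 1)).exists_monomial_of_mem_assPrimes hP
  refine not_forall_packs_single_add hk hmk a (fun h => ?_) fun v => ?_
  · refine (mem_assPrimes_iff.1 hP).1.ne_top ((Ideal.eq_top_iff_one _).2 ((ha 1).2 ?_))
    rw [one_mul, monomial_mem_edgeIdeal_pow]
    exact h
  · exact (monomial_mem_iff_packs ha _).1 (Ideal.subset_span ⟨v, rfl⟩)

theorem idealOfVars_mem_assPrimes (hdom : OddCyclesDominating G) {k m : ℕ}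
    (hk : HasCycleOfLength G (2 * k + 1)) (hm : k + 1 ≤ m) :
    idealOfVars V K ∈ assPrimes (edgeIdeal K G ^ m) := by
  classical
  obtain ⟨u, c, hc, hlen⟩ := hk
  obtain ⟨s, rfl⟩ := Nat.exists_eq_add_of_le hm
  have hadj := c.adj_snd hc.not_nil
  rw [idealOfVars_eq_span_X_image]
  refine span_X_image_mem_assPrimes (isMonomialIdeal_edgeIdeal_pow G _) _
    ((c.support.tail.map fun x => Finsupp.single x 1).sum +
      s • (Finsupp.single u 1 + Finsupp.single c.snd 1)) ?_ ?_
  · intro v _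
    rw [monomial_mem_edgeIdeal_pow, ← add_assoc]
    have hv : v ∈ {v | v ∈ c.support} ∪ nbrs G {v | v ∈ c.support} := by
      rw [hdom u c hc ⟨k, hlen⟩]
      trivial
    have h1 := (packs_single_add_closed_walk hlen hv).add ((Packs.edge hadj).nsmul s)
    rwa [mul_one] at h1
  · intro z hz h
    rw [monomial_mem_edgeIdeal_pow] at h
    obtain rfl : z = 0 := by
      ext v
      exact hz v trivial
    rw [zero_add] at h
    -- Degree count: the witness has degree 2k + 1 + 2s, while k + 1 + s edges need 2k + 2 + 2s.
    have h1 := h.mul_le_sum Finset.univ 2 fun i j _ _ _ => by simp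
    have h2 := sum_map_single_apply_le c.support.tail Finset.univ
    have h3 : c.support.tail.length = 2 * k + 1 := by simp [hlen]
    simp only [Finsupp.add_apply, Finset.sum_add_distrib, Finsupp.smul_apply, smul_eq_mul,
      ← Finset.mul_sum, Finsupp.single_apply, Finset.sum_ite_eq, Finset.mem_univ, if_true] at h1
    omega

/-- An odd cycle which is not dominating gives rise to a persistent prime which is neither minimal
nor the irrelevant ideal. -/
theorem exists_isPersistentPrime_of_not_dominating (hconn : G.Connected) {u : V} (c : G.Walk u u)
    {r : ℕ} (hlen : c.length = 2 * r + 1)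
    (hnd : {v | v ∈ c.support} ∪ nbrs G {v | v ∈ c.support} ≠ Set.univ) :
    ∃ P : Ideal (MvPolynomial V K), IsPersistentPrime (edgeIdeal K G) P ∧
      P ∉ (edgeIdeal K G).minimalPrimes ∧ P ≠ idealOfVars V K := by
  classical
  have hn : ¬ c.Nil := by
    rw [SimpleGraph.Walk.not_nil_iff_lt_length]
    omega
  set S : Set V := {v | v ∈ c.support} ∪ nbrs G {v | v ∈ c.support} with hS
  -- `A` is a maximal independent set outside `S` containing `w`; by maximality every vertex outside
  -- S ∪ A has a neighbour in `A`.
  obtain ⟨w, hw⟩ := (Set.ne_univ_iff_exists_notMem S).1 hnd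
  obtain ⟨A, hwA, hA⟩ := (Set.toFinite {A : Finset V | (∀ v ∈ A, v ∉ S) ∧
    ∀ v ∈ A, ∀ v' ∈ A, ¬ G.Adj v v'}).exists_le_maximal (a := {w}) (by simp [hw])
  have hAS := hA.prop.1
  have hAind := hA.prop.2
  have hwA : w ∈ A := hwA (Finset.mem_singleton_self w)
  let U : Set V := {v | v ∉ A}
  have hSU : ∀ v ∈ S, v ∈ U := fun v hv h => hAS v h hv
  have huS : u ∈ S := Or.inl c.start_mem_support
  let z : V →₀ ℕ := (c.support.tail.map fun x => Finsupp.single x 1).sum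
  let a : V →₀ ℕ := z + ∑ x ∈ A, Finsupp.single x 1
  have hsingle : ∀ v, (∑ x ∈ A, Finsupp.single x 1 : V →₀ ℕ) v = if v ∈ A then 1 else 0 := by
    intro v
    rw [Finsupp.finsetSum_apply]
    simp [Finsupp.single_apply]
  have hz : ∀ v, z v ≠ 0 → v ∈ c.support :=
    fun v hv => List.mem_of_mem_tail (mem_of_sum_map_single_apply_ne_zero hv)
  have hass : (Ideal.span (X '' U) : Ideal (MvPolynomial V K)) ∈
      assPrimes (edgeIdeal K G ^ (r + 1)) := by
    refine span_X_image_mem_assPrimes (isMonomialIdeal_edgeIdeal_pow G _) _ a ?_ ?_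
    · intro v hv
      rw [monomial_mem_edgeIdeal_pow]
      by_cases hvS : v ∈ S
      · refine (packs_single_add_closed_walk hlen hvS).mono_right ?_
        rw [← add_assoc]
        exact le_self_add
      · obtain ⟨x, hx, hvx⟩ : ∃ x ∈ A, G.Adj x v := by
          by_contra! hcon
          have h1 := hA.le_of_ge (y := insert v A) ⟨?_, ?_⟩ (Finset.subset_insert v A)
          · exact hv (h1 (Finset.mem_insert_self v A))
          · intro x hx
            rcases Finset.mem_insert.1 hx with rfl | hx
            · exact hvS
            · exact hAS x hx
          · intro x hx y hy
            rcases Finset.mem_insert.1 hx with hxv | hxA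
            · rcases Finset.mem_insert.1 hy with hyv | hyA
              · rw [hxv, hyv]
                exact G.loopless.irrefl _
              · rw [hxv]
                exact fun h => hcon y hyA h.symm
            · rcases Finset.mem_insert.1 hy with hyv | hyA
              · rw [hyv]
                exact hcon x hxA
              · exact hAind x hxA y hyA
        refine ((packs_closed_walk hlen).add (Packs.edge hvx)).mono_right ?_
        have h1 : Finsupp.single x 1 ≤ (∑ x ∈ A, Finsupp.single x 1 : V →₀ ℕ) :=
          Finset.single_le_sum (f := fun x => (Finsupp.single x 1 : V →₀ ℕ))
            (fun _ _ => zero_le) hx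
        calc z + (Finsupp.single x 1 + Finsupp.single v 1)
            = Finsupp.single v 1 + (z + Finsupp.single x 1) := by abel
          _ ≤ Finsupp.single v 1 + a := by
            gcongr
            exact add_le_add_right h1 z
    · intro y hy h
      rw [monomial_mem_edgeIdeal_pow] at h
      have hsupp : ∀ i, (y + a) i ≠ 0 → i ∈ A ∨ i ∈ c.support := by
        intro i hi
        by_cases hiA : i ∈ A
        · exact Or.inl hiA
        · right
          refine hz i fun h0 => hi ?_
          simp only [a, Finsupp.add_apply, hy i hiA, h0, hsingle, hiA, if_false, add_zero]
      have hout : ∀ i j, G.Adj i j → (y + a) j ≠ 0 → i ∉ A := by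
        intro i j hij hj hiA
        rcases hsupp j hj with hjA | hjc
        · exact hAind i hiA j hjA hij
        · exact hAS i hiA (Or.inr ⟨j, hjc, hij.symm⟩)
      -- `A` is independent and has no neighbours on the walk, so usable edges avoid `A`; but the
      -- weight outside `A` is at most 2r + 1.
      have h1 := h.mul_le_sum (Finset.univ \ A) 2 fun i j hij hi hj => by
        simp [hout i j hij hj, hout j i hij.symm hi]
      have h2 : ∑ v ∈ Finset.univ \ A, (y + a) v = ∑ v ∈ Finset.univ \ A, z v := by
        refine Finset.sum_congr rfl fun v hv => ?_
        have hvA : v ∉ A := (Finset.mem_sdiff.1 hv).2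
        simp only [a, Finsupp.add_apply, hy v hvA, hsingle, hvA, if_false, add_zero, zero_add]
      have h3 := sum_map_single_apply_le c.support.tail (Finset.univ \ A)
      have h4 : c.support.tail.length = 2 * r + 1 := by simp [hlen]
      rw [h2] at h1
      change ∑ v ∈ Finset.univ \ A, z v ≤ _ at h3
      omega
  have : Nontrivial V := ⟨u, w, fun h => hw (h ▸ huS)⟩
  obtain ⟨x, hwx⟩ := hconn.preconnected.exists_adj_of_nontrivial w
  refine ⟨Ideal.span (X '' U), ⟨isPrime_span_X_image U, isMonomialIdeal_span_X_image U,
    edgeIdeal_le_of_mem_assPrimes hass, ⟨r + 1, by omega, hass⟩, fun m _ hm => ?_⟩, ?_, ?_⟩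
  · exact mem_assPrimes_succ_of_adj hm hwx.symm
      (fun h => X_mem_span_X_image.1 h hwA)
  · intro hmin
    -- All neighbours of `u` lie in `S`, hence in `U`, so `u` is redundant in the vertex cover `U`.
    have h1 : edgeIdeal K G ≤ Ideal.span (X '' (U \ {u})) := by
      rw [edgeIdeal_le_iff (isPrime_span_X_image _)]
      simp only [X_mem_span_X_image]
      have hnb : ∀ j, G.Adj u j → j ∈ U \ {u} := fun j hj =>
        ⟨hSU j (Or.inr ⟨u, c.start_mem_support, hj⟩), hj.ne'⟩
      intro i j hij
      by_cases hi : i = u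
      · subst hi
        exact Or.inr (hnb j hij)
      by_cases hj : j = u
      · subst hj
        exact Or.inl (hnb i hij.symm)
      by_cases hiA : i ∈ A
      · exact Or.inr ⟨fun hjA => hAind i hiA j hjA hij, hj⟩
      · exact Or.inl ⟨hiA, hi⟩
    have h2 := hmin.2 ⟨isPrime_span_X_image _, h1⟩
      (Ideal.span_mono (Set.image_mono Set.sdiff_subset))
    have h3 := X_mem_span_X_image.1 (h2 (X_mem_span_X_image.2 (hSU u huS)))
    exact h3.2 rfl
  · intro h
    have h1 : (X w : MvPolynomial V K) ∈ Ideal.span (X '' U) := by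
      rw [h]
      exact Ideal.subset_span ⟨w, rfl⟩
    exact X_mem_span_X_image.1 h1 hwA

end AssociatedPrimes

/-! ### The main theorem -/

theorem theorem1p3 (K : Type*) [Field K] (n : ℕ) (G : SimpleGraph (Fin n))
    (hconn : G.Connected) (k : ℕ)
    (hk : IsLeast {j : ℕ | HasCycleOfLength G (2 * j + 1)} k) :
    (assInfty (edgeIdeal K G) = (edgeIdeal K G).minimalPrimes ∪ {idealOfVars (Fin n) K} ↔
      OddCyclesDominating G) ∧
    (OddCyclesDominating G →
      (∀ m, 1 ≤ m → m ≤ k →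
        assPrimes (edgeIdeal K G ^ m) = (edgeIdeal K G).minimalPrimes) ∧
      (∀ m, k + 1 ≤ m →
        assPrimes (edgeIdeal K G ^ m) =
          (edgeIdeal K G).minimalPrimes ∪ {idealOfVars (Fin n) K}) ∧
      IsAlmostNormallyTorsionfree (edgeIdeal K G)) := by
  have : Nonempty (Fin n) := hconn.nonempty
  have hkmin : ∀ j, HasCycleOfLength G (2 * j + 1) → k ≤ j := fun j hj => hk.2 hj
  have hk1 : 1 ≤ k := by
    obtain ⟨u, c, hc, hlen⟩ := hk.1
    have := hc.three_le_length
    omega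
  have hmonP : ∀ {m : ℕ} {P}, P ∈ assPrimes (edgeIdeal K G ^ m) → IsMonomialIdeal P := by
    intro m P hP
    have hJ := isMonomialIdeal_edgeIdeal_pow (K := K) G m
    obtain ⟨a, ha⟩ := hJ.exists_monomial_of_mem_assPrimes hP
    rw [eq_span_X_of_colon hJ (mem_assPrimes_iff.1 hP).1 ha]
    exact isMonomialIdeal_span_X_image _
  have hmin : ∀ {m : ℕ}, 1 ≤ m → (edgeIdeal K G).minimalPrimes ⊆ assPrimes (edgeIdeal K G ^ m) :=
    fun hm => minimalPrimes_subset_assPrimes_pow (by omega)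
  have hlow : OddCyclesDominating G → ∀ m, 1 ≤ m → m ≤ k →
      assPrimes (edgeIdeal K G ^ m) = (edgeIdeal K G).minimalPrimes := by
    intro hdom m hm hmk
    refine Set.Subset.antisymm (fun P hP => ?_) (hmin hm)
    refine (eq_idealOfVars_or_mem_minimalPrimes hdom hP).resolve_left ?_
    rintro rfl
    exact idealOfVars_notMem_assPrimes hkmin hm hmk hP
  have hhigh : OddCyclesDominating G → ∀ m, k + 1 ≤ m → assPrimes (edgeIdeal K G ^ m) =
      (edgeIdeal K G).minimalPrimes ∪ {idealOfVars (Fin n) K} := by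
    intro hdom m hm
    refine Set.Subset.antisymm (fun P hP => (eq_idealOfVars_or_mem_minimalPrimes hdom hP).symm) ?_
    refine Set.union_subset (hmin (by omega)) ?_
    rintro _ rfl
    exact idealOfVars_mem_assPrimes hdom hk.1 hm
  refine ⟨⟨fun h => ?_, fun hdom => ?_⟩, fun hdom => ⟨hlow hdom, hhigh hdom, ?_⟩⟩
  · intro u c hc ⟨r, hr⟩
    by_contra hnd
    obtain ⟨P, hP, hP1, hP2⟩ :=
      exists_isPersistentPrime_of_not_dominating (K := K) hconn c hr hnd
    have h1 : P ∈ assInfty (edgeIdeal K G) := hP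
    rw [h] at h1
    rcases h1 with h1 | h1
    · exact hP1 h1
    · exact hP2 h1
  · refine Set.Subset.antisymm ?_ ?_
    · rintro P ⟨-, -, -, ⟨m, -, hm⟩, -⟩
      exact (eq_idealOfVars_or_mem_minimalPrimes hdom hm).symm
    · have hper : ∀ {P m}, P ∈ assPrimes (edgeIdeal K G ^ m) → 1 ≤ m →
          (∀ m, 1 ≤ m → P ∈ assPrimes (edgeIdeal K G ^ m) →
            P ∈ assPrimes (edgeIdeal K G ^ (m + 1))) → P ∈ assInfty (edgeIdeal K G) :=
        fun hP hm h => ⟨(mem_assPrimes_iff.1 hP).1, hmonP hP, edgeIdeal_le_of_mem_assPrimes hP,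
          ⟨_, hm, hP⟩, h⟩
      rintro P (hP | rfl)
      · exact hper (hmin le_rfl hP) le_rfl fun m _ _ => hmin (by omega) hP
      -- 𝔪 is associated to no power up to `k` and to all later ones, hence persistent.
      · refine hper (idealOfVars_mem_assPrimes hdom hk.1 le_rfl) (by omega) fun m hm hP => ?_
        refine idealOfVars_mem_assPrimes hdom hk.1 ?_
        by_contra hlt
        exact idealOfVars_notMem_assPrimes hkmin hm (by omega) hP
  · have hm := idealOfVars_mem_assPrimes (K := K) hdom hk.1 le_rfl
    exact ⟨isMonomialIdeal_edgeIdeal G, k, hk1, _, (mem_assPrimes_iff.1 hm).1, hmonP hm,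
      hlow hdom, fun m hm => (hhigh hdom m hm).subset⟩
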